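/- Let $M$ be a smooth $n$-dimensional manifold without boundary (Hausdorff and $\sigma$-compact), with a countable locally finite atlas $(\phi_\alpha)_{\alpha\in A}$ of charts $\phi_\alpha\colon U_\alpha\to\mathbb R^n$, each a smooth bijection onto $\mathbb{R}^n$ with smooth inverse, such that the sets $V_\alpha=\phi_\alpha^{-1}(B_{\mathbb R^n}(0,1))$ cover $M$. Let $P$ be a continuous fibre seminorm on $T^*M$: a continuous function $P\colon T^*M\to[0,\infty)$ whose restriction to each fibre $T_x^*M$ is a seminorm. For $v\in T_xM$ put $P^*(v)=\sup\{|\xi(v)| : \xi\in T^*_xM,\ P(\xi)\le 1\}\in[0,\infty]$, and call $v$ $P$-subunit if $P^*(v)\le 1$. A smooth vector field on an open subset of $M$ is $P$-subunit there if its value at each point of that subset is $P$-subunit; a "$P$-subunit vector field" without further mention is one on all of $M$. A curve $\gamma\colon[a,b]\to M$ is $P$-subunit if it is absolutely continuous (that is, continuous and such that each $\phi_\alpha\circ\gamma$ is absolutely continuous on every compact subinterval of $[a,b]$ that $\gamma$ maps into $U_\alpha$) and $\gamma'(t)$ is $P$-subunit for almost every $t\in[a,b]$. A $P$-subunit piecewise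 flow curve on $[a,b]$ is a concatenation of finitely many flow curves (integral curves) of $P$-subunit vector fields on $M$. Suppose that $P$ satisfies the Lipschitz seminorm condition: for every $\alpha\in A$ there are a countable family $\mathfrak X$ of $P$-subunit vector fields on $U_\alpha$ and a constant $L$ (both may depend on $\alpha$) such that (i) $|\tau_\alpha X(p)-\tau_\alpha X(q)|\le L|p-q|$ for all $p,q\in B_{\mathbb R^n}(0,1)$ and all $X\in\mathfrak X$, where $\tau_\alpha X\colon\mathbb R^n\to\mathbb R^n$ is the expression of $X$ in the coordinates $\phi_\alpha$; and (ii) for all $x\in V_\alpha$, the closure of $\{X|_x : X\in\mathfrak X\}$ in $T_xM$ is $\{v\in T_xM : P^*(v)\le1\}$. Let $T\ge 0$ and let $\gamma\colon[0,T]\to M$ be a $P$-subunit curve. Then for every neighbourhood $W$ of $\gamma(T)$ there is a neighbourhood $U$ of $\gamma(0)$ such that, for every $x\in U$, there is a $P$-subunit piecewise flow curve $\delta\colon[0,T]\to M$ with $\delta(0)=x$ and $\delta(T)\in W$. -/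

import Mathlib

open scoped Manifold ContDiff ENNReal

namespace SubFinsler

section

variable {n : ℕ} {M : Type*} [TopologicalSpace M] [ChartedSpace (EuclideanSpace ℝ (Fin n)) M]

/-- The cotangent space `T*_x M`, the fibre at `x` of Mathlib's bundle of continuous linear maps
from the tangent bundle to the trivial line bundle. -/
abbrev CotangentSpace (n : ℕ) {M : Type*} [TopologicalSpace M]
    [ChartedSpace (EuclideanSpace ℝ (Fin n)) M] (x : M) : Type :=
  TangentSpace (𝓡 n) x →L[ℝ] Bundle.Trivial M ℝ x

/-- The cotangent bundle `T*M`, with its bundle topology. -/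
abbrev CotangentBundle (n : ℕ) (M : Type*) [TopologicalSpace M]
    [ChartedSpace (EuclideanSpace ℝ (Fin n)) M] :=
  Bundle.TotalSpace (EuclideanSpace ℝ (Fin n) →L[ℝ] ℝ) (CotangentSpace n : M → Type)

/-- A countable locally finite atlas of charts `φ α : U α → ℝⁿ`, each a smooth bijection onto the
whole of `ℝⁿ` with smooth inverse, such that the sets `V α = (φ α)⁻¹(B(0,1))` cover `M`. -/
structure BallAtlas (n : ℕ) (M : Type*) [TopologicalSpace M]
    [ChartedSpace (EuclideanSpace ℝ (Fin n)) M] (A : Type*) where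
  /-- the charts -/
  φ : A → OpenPartialHomeomorph M (EuclideanSpace ℝ (Fin n))
  countable : Countable A
  smooth : ∀ α, φ α ∈ IsManifold.maximalAtlas (𝓡 n) ∞ M
  target_eq : ∀ α, (φ α).target = Set.univ
  locallyFinite : LocallyFinite fun α => (φ α).source
  cover : ∀ x : M, ∃ α, x ∈ (φ α).source ∧ φ α x ∈ Metric.ball 0 1

/-- The domain `U α` of the chart `φ α`. -/
def BallAtlas.U {A : Type*} (𝒜 : BallAtlas n M A) (α : A) : Set M := (𝒜.φ α).source

/-- The set `V α = (φ α)⁻¹(B(0,1))`. -/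
def BallAtlas.V {A : Type*} (𝒜 : BallAtlas n M A) (α : A) : Set M :=
  {x | x ∈ (𝒜.φ α).source ∧ 𝒜.φ α x ∈ Metric.ball 0 1}

/-- A continuous fibre seminorm on `T*M`: a seminorm on every fibre `T*_x M`, continuous as a
function on the total space. -/
structure FibreSeminorm (n : ℕ) (M : Type*) [TopologicalSpace M]
    [ChartedSpace (EuclideanSpace ℝ (Fin n)) M] [IsManifold (𝓡 n) ∞ M] where
  /-- the seminorm on the fibre at `x` -/
  seminorm : ∀ x : M, Seminorm ℝ (CotangentSpace n x)
  continuous : Continuous fun ξ : CotangentBundle n M => seminorm ξ.proj ξ.snd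

section

variable [IsManifold (𝓡 n) ∞ M] (P : FibreSeminorm n M)

/-- The dual extended fibre norm `P*(v) = sup {|ξ(v)| : P(ξ) ≤ 1}` on `TM`. -/
noncomputable def FibreSeminorm.dual (x : M) (v : TangentSpace (𝓡 n) x) : ℝ≥0∞ :=
  ⨆ (ξ : CotangentSpace n x) (_ : P.seminorm x ξ ≤ 1), ENNReal.ofReal |(ξ v : ℝ)|

/-- A tangent vector is `P`-subunit if `P*(v) ≤ 1`. -/
def FibreSeminorm.IsSubunit (x : M) (v : TangentSpace (𝓡 n) x) : Prop := P.dual x v ≤ 1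

/-- `X` is a smooth `P`-subunit vector field on the set `U`. -/
def FibreSeminorm.IsSubunitFieldOn (X : ∀ x : M, TangentSpace (𝓡 n) x) (U : Set M) : Prop :=
  ContMDiffOn (𝓡 n) (𝓡 n).tangent ∞ (fun x => (⟨x, X x⟩ : TangentBundle (𝓡 n) M)) U ∧
    ∀ x ∈ U, P.IsSubunit x (X x)

/-- `X` is a `P`-subunit vector field: smooth and `P`-subunit everywhere in `M`. -/
def FibreSeminorm.IsSubunitField (X : ∀ x : M, TangentSpace (𝓡 n) x) : Prop :=
  P.IsSubunitFieldOn X Set.univ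

end

/-- The expression `τ X : ℝⁿ → ℝⁿ` of a vector field `X` in the coordinates `φ`. -/
noncomputable def coordField (φ : OpenPartialHomeomorph M (EuclideanSpace ℝ (Fin n)))
    (X : ∀ x : M, TangentSpace (𝓡 n) x) (p : EuclideanSpace ℝ (Fin n)) :
    EuclideanSpace ℝ (Fin n) :=
  mfderiv (𝓡 n) (𝓡 n) φ (φ.symm p) (X (φ.symm p))

/-- A curve `γ` on `[a,b]` (values outside `[a,b]` are irrelevant) is absolutely continuous if it
is continuous and each `φ α ∘ γ` is locally absolutely continuous where it is defined, i.e.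
absolutely continuous on each compact subinterval that `γ` maps to the domain of `φ α`. -/
def IsACCurve {A : Type*} (𝒜 : BallAtlas n M A) (γ : ℝ → M) (a b : ℝ) : Prop :=
  ContinuousOn γ (Set.Icc a b) ∧
    ∀ (α : A) (c d : ℝ), a ≤ c → c ≤ d → d ≤ b → (∀ t ∈ Set.Icc c d, γ t ∈ 𝒜.U α) →
      AbsolutelyContinuousOnInterval (fun t => 𝒜.φ α (γ t)) c d

variable [IsManifold (𝓡 n) ∞ M] (P : FibreSeminorm n M)

/-- A curve `γ` on `[a,b]` is `P`-subunit if it is absolutely continuous and for almost every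
`t ∈ [a,b]` the derivative `γ'(t)` exists and is a `P`-subunit vector. -/
def FibreSeminorm.IsSubunitCurve {A : Type*} (𝒜 : BallAtlas n M A) (γ : ℝ → M) (a b : ℝ) : Prop :=
  IsACCurve 𝒜 γ a b ∧
    ∀ᵐ t ∂(MeasureTheory.volume.restrict (Set.Icc a b)),
      ∃ v : TangentSpace (𝓡 n) (γ t),
        HasMFDerivWithinAt 𝓘(ℝ, ℝ) (𝓡 n) γ (Set.Icc a b) t
          ((1 : ℝ →L[ℝ] ℝ).smulRight v) ∧
        P.IsSubunit (γ t) v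

/-- A curve `δ` on `[a,b]` is a `P`-subunit piecewise flow curve if `[a,b]` has a finite
subdivision `a = t 0 ≤ ⋯ ≤ t k = b` such that `δ` is, on each `[t j, t (j+1)]`, a flow curve
(integral curve) of some `P`-subunit vector field on `M`. -/
def FibreSeminorm.IsPiecewiseFlowCurve (δ : ℝ → M) (a b : ℝ) : Prop :=
  ∃ (k : ℕ) (t : Fin (k + 1) → ℝ), Monotone t ∧ t 0 = a ∧ t (Fin.last k) = b ∧
    ∀ j : Fin k, ∃ X : ∀ x : M, TangentSpace (𝓡 n) x,
      P.IsSubunitField X ∧ IsMIntegralCurveOn δ X (Set.Icc (t j.castSucc) (t j.succ))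

/-- The Lipschitz seminorm condition: for every chart `α` there are a countable family `𝒳` of
`P`-subunit vector fields on `U α` and a constant `L` such that the fields of `𝒳` are
`L`-Lipschitz on the unit ball in the coordinates `φ α`, and at each `x ∈ V α` their values have
closure the unit ball of `P*` in `T_x M`. -/
def FibreSeminorm.LipschitzCondition {A : Type*} (𝒜 : BallAtlas n M A) : Prop :=
  ∀ α : A, ∃ (𝒳 : Set (∀ x : M, TangentSpace (𝓡 n) x)) (L : ℝ), 𝒳.Countable ∧
    (∀ X ∈ 𝒳, P.IsSubunitFieldOn X (𝒜.U α)) ∧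
    (∀ X ∈ 𝒳, ∀ p ∈ Metric.ball (0 : EuclideanSpace ℝ (Fin n)) 1,
      ∀ q ∈ Metric.ball (0 : EuclideanSpace ℝ (Fin n)) 1,
        ‖coordField (𝒜.φ α) X p - coordField (𝒜.φ α) X q‖ ≤ L * ‖p - q‖) ∧
    ∀ x ∈ 𝒜.V α,
      closure {v : TangentSpace (𝓡 n) x | ∃ X ∈ 𝒳, X x = v} = {v | P.dual x v ≤ 1}

end

end SubFinsler

/-!
A subunit curve is followed by flow curves of finitely many global subunit fields, chart by chart.

Inside one set `V α` the curve `γ` stays, by compactness, in a smaller ball `B(0, ρ)` of the chart.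
Multiplying the fields of the Lipschitz condition by a cutoff function that is `1` on `B(0, ρ)`
gives global subunit fields, since the unit balls of `P*` are star-shaped, and their coordinate
expressions are bounded and Lipschitz on all of `ℝⁿ` with a uniform constant
(`FibreSeminorm.LipschitzCondition.exists_global_family`).

A vector `v` is subunit exactly if `|ξ v| ≤ P ξ` for all covectors `ξ`. Integrating this inequality
along `γ`, for covectors `ξ` with constant coordinates, and using the continuity of `P`, one sees
that all limits of the slopes of chords of `γ` at times tending to `t₀` are subunit at `γ t₀`. As
the values of the fields are dense in the unit ball of `P*` there, each short chord of `γ` near `t₀`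
is almost parallel to one of the fields (`FibreSeminorm.IsSubunitCurve.exists_chord_approx`). Hence
`γ` may be replaced by a fine polygon whose edges are approximate integral curves, and Grönwall's
inequality bounds the distance between the end of the polygon and the end of the concatenated flow
curve (`FibreSeminorm.LipschitzCondition.exists_flowReach_of_mem_V`).

The result for `[0, T]` follows by subdividing it into intervals that `γ` maps into sets `V α`, and
pulling neighbourhoods of the points of `γ` back along the subdivision.
-/

open Set Filter Topology MeasureTheory

/-! ### Curves in Euclidean space -/


theorem AbsolutelyContinuousOnInterval.abs_sub_le_of_ae_abs_deriv_le {f : ℝ → ℝ} {a b C : ℝ}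
    (hab : a ≤ b) (hf : AbsolutelyContinuousOnInterval f a b)
    (hC : ∀ᵐ t ∂(volume.restrict (Icc a b)), |deriv f t| ≤ C) :
    |f b - f a| ≤ C * (b - a) := by
  rw [← hf.integral_deriv_eq_sub, ← Real.norm_eq_abs, ← abs_of_nonneg (sub_nonneg.2 hab)]
  refine intervalIntegral.norm_integral_le_of_norm_le_const_ae ?_
  rw [ae_restrict_iff' measurableSet_Icc] at hC
  filter_upwards [hC] with t ht hmem
  rw [uIoc_of_le hab] at hmem
  exact ht (Ioc_subset_Icc_self hmem)

theorem LipschitzWith.comp_absolutelyContinuousOnInterval {X Y : Type*} [PseudoMetricSpace X]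
    [PseudoMetricSpace Y] {g : X → Y} {K : NNReal} (hg : LipschitzWith K g) {f : ℝ → X} {a b : ℝ}
    (hf : AbsolutelyContinuousOnInterval f a b) :
    AbsolutelyContinuousOnInterval (fun t => g (f t)) a b := by
  refine squeeze_zero (fun E => Finset.sum_nonneg fun i _ => dist_nonneg) (fun E => ?_)
    (by simpa using Tendsto.const_mul (K : ℝ) hf)
  rw [Finset.mul_sum]
  exact Finset.sum_le_sum fun i _ => hg.dist_le_mul _ _

theorem exists_hasDerivWithinAt_Icc_of_lipschitzWith_of_bounded {E : Type*} [NormedAddCommGroup E]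
    [NormedSpace ℝ E] [CompleteSpace E] {F : E → E} {K : NNReal} (hF : LipschitzWith K F)
    {C : ℝ} (hC : ∀ x, ‖F x‖ ≤ C) {a b : ℝ} (hab : a ≤ b) (y : E) :
    ∃ d : ℝ → E, d a = y ∧ ∀ t ∈ Icc a b, HasDerivWithinAt d (F (d t)) (Icc a b) t := by
  have hC0 : 0 ≤ C := (norm_nonneg _).trans (hC y)
  have hR : 0 ≤ C * (b - a) := mul_nonneg hC0 (sub_nonneg.2 hab)
  -- a bounded field cannot leave the ball of radius `C * (b - a)` during the time `b - a`
  have : IsPicardLindelof (fun _ => F) (⟨a, left_mem_Icc.2 hab⟩ : Icc a b) y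
      ⟨C * (b - a), hR⟩ 0 ⟨C, hC0⟩ K := by
    refine IsPicardLindelof.of_time_independent (fun x _ => hC x) hF.lipschitzOnWith ?_
    simp [max_eq_left (sub_nonneg.2 hab)]
    exact le_rfl
  exact this.exists_eq_forall_mem_Icc_hasDerivWithinAt₀

/-- Grönwall's inequality, comparing an integral curve `d` of `F` with the affine motion from `p`
to `q`. Adding `ε / K` to the distances makes the estimate multiplicative in time, so that it can
be iterated along a subdivision. -/
theorem dist_add_le_of_chord {E : Type*} [NormedAddCommGroup E]
    [NormedSpace ℝ E] {F : E → E} {K : NNReal} (hK : 0 < K) (hF : LipschitzWith K F)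
    {a b ε : ℝ} (hab : a < b) {p q : E}
    (hε : ∀ z ∈ segment ℝ p q, ‖(b - a)⁻¹ • (q - p) - F z‖ ≤ ε) {d : ℝ → E}
    (hd : ∀ t ∈ Icc a b, HasDerivWithinAt d (F (d t)) (Icc a b) t) :
    dist (d b) q + ε / K ≤ (dist (d a) p + ε / K) * Real.exp (K * (b - a)) := by
  have hK' : (K : ℝ) ≠ 0 := by exact_mod_cast hK.ne'
  have hba : 0 < b - a := sub_pos.2 hab
  set w := (b - a)⁻¹ • (q - p) with hw
  let g : ℝ → E := fun t => p + (t - a) • w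
  have hg : ∀ t, HasDerivAt g w t := fun t => by
    simpa [g] using (((hasDerivAt_id t).sub_const a).smul_const w).const_add p
  have hgb : g b = q := by
    simp only [g, hw, smul_smul, mul_inv_cancel₀ hba.ne', one_smul, add_sub_cancel]
  have hga : g a = p := by simp [g]
  have key := dist_le_of_approx_trajectories_ODE (v := fun _ => F) (K := K) (f := d) (g := g)
    (f' := fun t => F (d t)) (g' := fun _ => w) (a := a) (b := b) (εf := 0) (εg := ε)
    (δ := dist (d a) p) (fun _ => hF) (fun t ht => (hd t ht).continuousWithinAt)
    (fun t ht => (hd t (Ico_subset_Icc_self ht)).mono_of_mem_nhdsWithin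
      (Icc_mem_nhdsGE_of_mem ht)) (fun t _ => by simp)
    (fun t _ => (hg t).continuousAt.continuousWithinAt) (fun t _ => (hg t).hasDerivWithinAt)
    (fun t ht => by
      rw [dist_eq_norm]
      refine hε _ ?_
      rw [segment_eq_image']
      refine ⟨(t - a) / (b - a), ⟨div_nonneg (sub_nonneg.2 ht.1) hba.le,
        (div_le_one hba).2 (by linarith [ht.2])⟩, ?_⟩
      simp only [g, hw, smul_smul, div_eq_mul_inv])
    (by rw [hga]) b (right_mem_Icc.2 hab.le)
  rw [hgb, gronwallBound_of_K_ne_0 hK', zero_add] at key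
  calc dist (d b) q + ε / K ≤ _ := add_le_add_left key _
    _ = _ := by ring

theorem EuclideanSpace.norm_le_sum_abs_apply {n : ℕ} (w : EuclideanSpace ℝ (Fin n)) :
    ‖w‖ ≤ ∑ j, |w j| := by
  have hsum : w = ∑ j, w j • EuclideanSpace.single j (1 : ℝ) := by
    ext k
    simp [Finset.sum_apply, Pi.single_apply]
  conv_lhs => rw [hsum]
  refine (norm_sum_le _ _).trans (Finset.sum_le_sum fun j _ => ?_)
  simp [norm_smul]

/-- If the limit points of `w` satisfy all the inequalities `|ξ v| ≤ p ξ`, and the set of the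
solutions of these inequalities lies in the closure of `S`, then `w` gets close to `S`. -/
theorem eventually_exists_norm_sub_lt_of_forall_functional {ι : Type*} {n : ℕ} {l : Filter ι}
    {w : ι → EuclideanSpace ℝ (Fin n)} {p : (EuclideanSpace ℝ (Fin n) →L[ℝ] ℝ) → ℝ}
    (h : ∀ ξ, ∀ η > 0, ∀ᶠ i in l, |ξ (w i)| ≤ p ξ + η) {S : Set (EuclideanSpace ℝ (Fin n))}
    (hS : ∀ v, (∀ ξ : EuclideanSpace ℝ (Fin n) →L[ℝ] ℝ, |ξ v| ≤ p ξ) → v ∈ closure S)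
    {ε : ℝ} (hε : 0 < ε) : ∀ᶠ i in l, ∃ x ∈ S, ‖w i - x‖ < ε := by
  by_contra hcon
  rw [not_eventually, frequently_iff_neBot] at hcon
  set l' := l ⊓ 𝓟 {i | ¬ ∃ x ∈ S, ‖w i - x‖ < ε}
  have hl' : l' ≤ l := inf_le_left
  -- the coordinate functionals confine `w` to a compact set
  obtain ⟨R, hR⟩ : ∃ R, ∀ᶠ i in l', w i ∈ Metric.closedBall 0 R := by
    refine ⟨∑ j : Fin n, (p (EuclideanSpace.proj j) + 1), ?_⟩
    have : ∀ᶠ i in l', ∀ j : Fin n,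
        |(EuclideanSpace.proj j : EuclideanSpace ℝ (Fin n) →L[ℝ] ℝ) (w i)| ≤
          p (EuclideanSpace.proj j) + 1 :=
      eventually_all.2 fun j => (h _ 1 one_pos).filter_mono hl'
    filter_upwards [this] with i hi
    rw [mem_closedBall_zero_iff]
    exact (EuclideanSpace.norm_le_sum_abs_apply _).trans (Finset.sum_le_sum fun j _ => hi j)
  obtain ⟨v, -, hv⟩ := (isCompact_closedBall (0 : EuclideanSpace ℝ (Fin n)) R).exists_clusterPt
    (f := map w l') (le_principal_iff.2 hR)
  have hvS : v ∈ closure S := by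
    refine hS v fun ξ => le_of_forall_pos_le_add fun η hη => ?_
    have hcl : IsClosed {u : EuclideanSpace ℝ (Fin n) | |ξ u| ≤ p ξ + η} :=
      isClosed_le (by fun_prop) continuous_const
    have hev : ∀ᶠ u in map w l', |ξ u| ≤ p ξ + η := (h ξ η hη).filter_mono hl'
    exact isClosed_iff_clusterPt.1 hcl v (hv.mono (le_principal_iff.2 hev))
  obtain ⟨x, hxS, hx⟩ := Metric.mem_closure_iff.1 hvS (ε / 2) (half_pos hε)
  have hfreq := (mapClusterPt_iff_frequently.1 hv) _ (Metric.ball_mem_nhds v (half_pos hε))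
  have hbad : ∀ᶠ i in l', ¬ ∃ x ∈ S, ‖w i - x‖ < ε := mem_inf_of_right (mem_principal_self _)
  obtain ⟨i, hi, hbi⟩ := (hfreq.and_eventually hbad).exists
  refine hbi ⟨x, hxS, ?_⟩
  rw [← dist_eq_norm]
  linarith [dist_triangle (w i) v x, Metric.mem_ball.1 hi]

/-- The product of a cutoff function with values in `[0, 1]` and support in a set `B`, and of a
map that is Lipschitz and bounded on `B`, is Lipschitz on the whole space. -/
theorem lipschitzWith_smul_of_support_subset {E V : Type*} [PseudoMetricSpace E]
    [NormedAddCommGroup V] [NormedSpace ℝ V] {χ : E → ℝ} {F : E → V} {B : Set E} {Kχ K C : NNReal}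
    (hχ : LipschitzWith Kχ χ) (hχ1 : ∀ x, |χ x| ≤ 1) (hχB : ∀ x ∉ B, χ x = 0)
    (hF : LipschitzOnWith K F B) (hC : ∀ x ∈ B, ‖F x‖ ≤ C) :
    LipschitzWith (K + Kχ * C) fun x => χ x • F x := by
  have hχ' : ∀ p q, |χ p - χ q| ≤ Kχ * dist p q := fun p q => by
    simpa [Real.dist_eq] using hχ.dist_le_mul p q
  have one : ∀ p q, p ∈ B → ‖χ p • F p - χ q • F q‖ ≤ (K + Kχ * C) * dist p q := by
    intro p q hp
    by_cases hq : q ∈ B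
    · have h1 : χ p • F p - χ q • F q = χ q • (F p - F q) + (χ p - χ q) • F p := by
        simp only [smul_sub, sub_smul]; abel
      rw [h1]
      refine (norm_add_le _ _).trans ?_
      rw [norm_smul, norm_smul, Real.norm_eq_abs, Real.norm_eq_abs]
      have h2 : ‖F p - F q‖ ≤ K * dist p q := by
        simpa [dist_eq_norm] using hF.dist_le_mul p hp q hq
      have h3 := mul_le_mul (hχ1 q) h2 (norm_nonneg _) zero_le_one
      have h4 := mul_le_mul (hχ' p q) (hC p hp) (norm_nonneg _) (by positivity)
      linarith
    · have h4 := mul_le_mul (hχ' p q) (hC p hp) (norm_nonneg _) (by positivity)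
      rw [hχB q hq, sub_zero] at h4
      rw [hχB q hq, zero_smul, sub_zero, norm_smul, Real.norm_eq_abs]
      have : 0 ≤ (K : ℝ) * dist p q := by positivity
      linarith
  refine LipschitzWith.of_dist_le_mul fun p q => ?_
  rw [dist_eq_norm]
  push_cast
  by_cases hp : p ∈ B
  · exact one p q hp
  by_cases hq : q ∈ B
  · rw [norm_sub_rev, dist_comm]
    exact one q p hq
  · rw [hχB p hp, hχB q hq, zero_smul, zero_smul, sub_zero, norm_zero]
    positivity

namespace SubFinsler

variable {n : ℕ} {M : Type*} [TopologicalSpace M] [ChartedSpace (EuclideanSpace ℝ (Fin n)) M]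

/-! ### Vectors and covectors in a chart -/

variable {φ : OpenPartialHomeomorph M (EuclideanSpace ℝ (Fin n))}

theorem mdifferentiable_of_mem_maximalAtlas_infty
    (hφ : φ ∈ IsManifold.maximalAtlas (𝓡 n) ∞ M) : φ.MDifferentiable (𝓡 n) (𝓡 n) :=
  ⟨(contMDiffOn_of_mem_maximalAtlas hφ).mdifferentiableOn (by simp),
    (contMDiffOn_symm_of_mem_maximalAtlas hφ).mdifferentiableOn (by simp)⟩

/-- The covector at `x` with the constant coordinates `ξ` in the chart `φ`, i.e. the pullback of
`ξ` along `φ`. -/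
noncomputable def chartCovector (φ : OpenPartialHomeomorph M (EuclideanSpace ℝ (Fin n)))
    (ξ : EuclideanSpace ℝ (Fin n) →L[ℝ] ℝ) (x : M) : CotangentSpace n x :=
  ξ.comp (mfderiv (𝓡 n) (𝓡 n) φ x)

theorem coordField_apply_of_mem_source (X : ∀ x : M, TangentSpace (𝓡 n) x) {x : M}
    (hx : x ∈ φ.source) : coordField φ X (φ x) = mfderiv (𝓡 n) (𝓡 n) φ x (X x) := by
  rw [coordField, φ.left_inv hx]

/-! ### Integral curves in a chart -/

theorem _root_.IsMIntegralCurveOn.congr_curve {σ τ : ℝ → M} {X : ∀ x : M, TangentSpace (𝓡 n) x}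
    {s : Set ℝ} (h : IsMIntegralCurveOn σ X s) (hs : EqOn τ σ s) : IsMIntegralCurveOn τ X s := by
  intro t ht
  have h1 := (h t ht).congr_of_eventuallyEq (hs.eventuallyEq_of_mem self_mem_nhdsWithin) (hs ht)
  rw [← hs ht] at h1
  exact h1

theorem mfderiv_symm_coordField (hφ : φ ∈ IsManifold.maximalAtlas (𝓡 n) ∞ M)
    (X : ∀ x : M, TangentSpace (𝓡 n) x) {p : EuclideanSpace ℝ (Fin n)} (hp : p ∈ φ.target) :
    mfderiv (𝓡 n) (𝓡 n) φ.symm p (coordField φ X p) = X (φ.symm p) := by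
  have hmd := mdifferentiable_of_mem_maximalAtlas_infty hφ
  refine hmd.mfderiv_injective (φ.map_target hp) ?_
  exact congrArg (fun T => T (coordField φ X p)) (hmd.comp_symm_deriv hp)

/-- Integral curves of the coordinate expression of `X` give integral curves of `X`; if the
coordinate expression is Lipschitz and bounded on `ℝⁿ`, they exist on all compact intervals. -/
theorem exists_isMIntegralCurveOn_symm (hφ : φ ∈ IsManifold.maximalAtlas (𝓡 n) ∞ M)
    (htarget : φ.target = univ) {X : ∀ x : M, TangentSpace (𝓡 n) x} {K : NNReal} {C : ℝ}
    (hK : LipschitzWith K (coordField φ X)) (hC : ∀ p, ‖coordField φ X p‖ ≤ C) {a b : ℝ}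
    (hab : a ≤ b) (y : EuclideanSpace ℝ (Fin n)) :
    ∃ d : ℝ → EuclideanSpace ℝ (Fin n), d a = y ∧
      (∀ t ∈ Icc a b, HasDerivWithinAt d (coordField φ X (d t)) (Icc a b) t) ∧
      IsMIntegralCurveOn (fun t => φ.symm (d t)) X (Icc a b) := by
  obtain ⟨d, hda, hd⟩ := exists_hasDerivWithinAt_Icc_of_lipschitzWith_of_bounded hK hC hab y
  refine ⟨d, hda, hd, fun t ht => ?_⟩
  have hmd := mdifferentiable_of_mem_maximalAtlas_infty hφ
  have hmem : d t ∈ φ.target := htarget ▸ mem_univ _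
  have h1 := (hmd.mdifferentiableAt_symm hmem).hasMFDerivAt
  have h2 := h1.comp_hasMFDerivWithinAt t (hd t ht).hasFDerivWithinAt.hasMFDerivWithinAt
  refine h2.congr_mfderiv ?_
  ext
  have h3 : ((1 : ℝ →L[ℝ] ℝ).smulRight (X (φ.symm (d t)))) (1 : ℝ) = X (φ.symm (d t)) := by simp
  have h4 : (ContinuousLinearMap.toSpanSingleton ℝ (coordField φ X (d t))) (1 : ℝ) =
      coordField φ X (d t) := by simp
  refine Eq.trans ?_ h3.symm
  exact (congrArg (mfderiv (𝓡 n) (𝓡 n) φ.symm (d t)) h4).trans (mfderiv_symm_coordField hφ X hmem)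

/-! ### Cutting off vector fields in a chart -/

/-- The vector field `X`, multiplied by the function that is `χ` in the coordinates `φ` and
vanishes outside the domain of `φ`. -/
noncomputable def cutoffField (φ : OpenPartialHomeomorph M (EuclideanSpace ℝ (Fin n)))
    (χ : EuclideanSpace ℝ (Fin n) → ℝ) (X : ∀ x : M, TangentSpace (𝓡 n) x) (x : M) :
    TangentSpace (𝓡 n) x :=
  φ.source.indicator (fun x => χ (φ x)) x • X x

theorem coordField_cutoffField {χ : EuclideanSpace ℝ (Fin n) → ℝ}
    (X : ∀ x : M, TangentSpace (𝓡 n) x) {p : EuclideanSpace ℝ (Fin n)} (hp : p ∈ φ.target) :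
    coordField φ (cutoffField φ χ X) p = χ p • coordField φ X p := by
  have h : cutoffField φ χ X (φ.symm p) = χ p • X (φ.symm p) := by
    rw [cutoffField, indicator_of_mem (φ.map_target hp), φ.right_inv hp]
  rw [coordField, h]
  exact (mfderiv (𝓡 n) (𝓡 n) φ (φ.symm p)).map_smul (χ p) _

variable [IsManifold (𝓡 n) ∞ M] {P : FibreSeminorm n M}

/-! ### Subunit vectors -/

/-- The unit ball of the dual norm is the intersection of the strips `|ξ v| ≤ P ξ`; this includes
the covectors with `P ξ = 0`, on which the supremum defining the dual norm imposes `ξ v = 0`. -/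
theorem FibreSeminorm.isSubunit_iff {x : M} {v : TangentSpace (𝓡 n) x} :
    P.IsSubunit x v ↔ ∀ ξ : CotangentSpace n x, |(ξ v : ℝ)| ≤ P.seminorm x ξ := by
  have hle : P.IsSubunit x v ↔
      ∀ ξ : CotangentSpace n x, P.seminorm x ξ ≤ 1 → |(ξ v : ℝ)| ≤ 1 := by
    simp only [FibreSeminorm.IsSubunit, FibreSeminorm.dual, iSup_le_iff, ENNReal.ofReal_le_one]
  rw [hle]
  refine ⟨fun h ξ => le_of_forall_pos_le_add fun η hη => ?_, fun h ξ hξ => (h ξ).trans hξ⟩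
  -- rescale `ξ` by a number slightly larger than `P ξ`, which is positive even if `P ξ = 0`
  have hpos : 0 < P.seminorm x ξ + η := add_pos_of_nonneg_of_pos (apply_nonneg _ _) hη
  have := h ((P.seminorm x ξ + η)⁻¹ • ξ) (by
    rw [map_smul_eq_mul, Real.norm_eq_abs, abs_of_pos (inv_pos.2 hpos), inv_mul_le_iff₀ hpos]
    linarith)
  have h2 : |(P.seminorm x ξ + η)⁻¹ * (ξ v : ℝ)| ≤ 1 := this
  rwa [abs_mul, abs_of_pos (inv_pos.2 hpos), inv_mul_le_iff₀ hpos, mul_one] at h2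

theorem FibreSeminorm.IsSubunit.smul {x : M} {v : TangentSpace (𝓡 n) x} (hv : P.IsSubunit x v)
    {r : ℝ} (hr : |r| ≤ 1) : P.IsSubunit x (r • v) := by
  rw [FibreSeminorm.isSubunit_iff] at hv ⊢
  intro ξ
  have h1 : (ξ (r • v) : ℝ) = r * (ξ v : ℝ) := ξ.map_smul r v
  rw [h1, abs_mul]
  calc |r| * |(ξ v : ℝ)| ≤ 1 * |(ξ v : ℝ)| := by gcongr
    _ ≤ P.seminorm x ξ := by rw [one_mul]; exact hv ξ

theorem FibreSeminorm.isSubunit_zero (x : M) : P.IsSubunit x (0 : TangentSpace (𝓡 n) x) := by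
  rw [FibreSeminorm.isSubunit_iff]
  intro ξ
  have h1 : (ξ (0 : TangentSpace (𝓡 n) x) : ℝ) = 0 := ξ.map_zero
  rw [h1, abs_zero]
  exact apply_nonneg _ _

/-! ### Reachability by concatenated flow curves -/

variable (P) in
/-- `P.FlowReach a x b y` means that `y` is reached at time `b` from `x` at time `a` by following
finitely many flow curves of `P`-subunit vector fields. -/
inductive FibreSeminorm.FlowReach : ℝ → M → ℝ → M → Prop
  | refl (a : ℝ) (x : M) : FlowReach a x a x
  | snoc {a b c : ℝ} {x : M} {σ : ℝ → M} {X : ∀ x : M, TangentSpace (𝓡 n) x}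
      (h : FlowReach a x b (σ b)) (hbc : b ≤ c) (hX : P.IsSubunitField X)
      (hσ : IsMIntegralCurveOn σ X (Icc b c)) : FlowReach a x c (σ c)

theorem FibreSeminorm.FlowReach.trans {a b c : ℝ} {x y z : M} (h₁ : P.FlowReach a x b y)
    (h₂ : P.FlowReach b y c z) : P.FlowReach a x c z := by
  induction h₂ with
  | refl => exact h₁
  | snoc _ hbc hX hσ ih => exact (ih h₁).snoc hbc hX hσ

theorem FibreSeminorm.FlowReach.exists_isPiecewiseFlowCurve {a b : ℝ} {x y : M}
    (h : P.FlowReach a x b y) : ∃ δ : ℝ → M, P.IsPiecewiseFlowCurve δ a b ∧ δ a = x ∧ δ b = y := by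
  classical
  induction h with
  | refl x =>
    exact ⟨fun _ => x, ⟨0, fun _ => a, monotone_const, rfl, rfl, fun j => j.elim0⟩, rfl, rfl⟩
  | @snoc b c x σ X _ hbc hX hσ ih =>
    obtain ⟨δ, ⟨k, t, ht, ht0, htk, hδ⟩, hδa, hδb⟩ := ih
    have hle : ∀ j, t j ≤ b := fun j => htk ▸ ht (Fin.le_last j)
    set δ' : ℝ → M := fun τ => if τ ≤ b then δ τ else σ τ with hδ'
    have hab : a ≤ b := ht0 ▸ hle 0
    have eq1 : ∀ τ ≤ b, δ' τ = δ τ := fun τ hτ => if_pos hτ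
    have eq2 : ∀ τ, b ≤ τ → δ' τ = σ τ := fun τ hτ => by
      rcases hτ.eq_or_lt with rfl | hlt
      · rw [eq1 _ le_rfl, hδb]
      · exact if_neg hlt.not_ge
    refine ⟨δ', ⟨k + 1, Fin.snoc (α := fun _ => ℝ) t c, ?_, ?_, ?_, ?_⟩, ?_, eq2 c hbc⟩
    · rw [Fin.monotone_iff_le_succ]
      intro j
      refine Fin.lastCases ?_ (fun i => ?_) j
      · rw [Fin.snoc_castSucc, Fin.succ_last, Fin.snoc_last]
        exact (hle _).trans hbc
      · rw [Fin.snoc_castSucc, Fin.succ_castSucc, Fin.snoc_castSucc]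
        exact ht (Fin.castSucc_le_succ i)
    · rw [← Fin.castSucc_zero, Fin.snoc_castSucc, ht0]
    · rw [Fin.snoc_last]
    · intro j
      refine Fin.lastCases ?_ (fun i => ?_) j
      · rw [Fin.snoc_castSucc, Fin.succ_last, Fin.snoc_last, htk]
        exact ⟨X, hX, hσ.congr_curve fun τ hτ => eq2 τ hτ.1⟩
      · rw [Fin.snoc_castSucc, Fin.succ_castSucc, Fin.snoc_castSucc]
        obtain ⟨Y, hY, hYδ⟩ := hδ i
        exact ⟨Y, hY, hYδ.congr_curve fun τ hτ => eq1 τ (hτ.2.trans (hle _))⟩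
    · rw [eq1 a hab, hδa]

/-! ### Subunit vectors in a chart -/

theorem continuousOn_chartCovector (hφ : φ ∈ IsManifold.maximalAtlas (𝓡 n) ∞ M)
    (ξ : EuclideanSpace ℝ (Fin n) →L[ℝ] ℝ) :
    ContinuousOn (fun x => (⟨x, chartCovector φ ξ x⟩ : CotangentBundle n M)) φ.source := by
  intro x₀ hx₀
  refine ContinuousAt.continuousWithinAt ?_
  rw [continuousAt_hom_bundle]
  refine ⟨continuousAt_id, ?_⟩
  have h := ((contMDiffAt_of_mem_maximalAtlas hφ hx₀).mfderiv_const (m := 0)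
    (by simp)).continuousAt
  have h2 := (ContinuousLinearMap.compL ℝ (EuclideanSpace ℝ (Fin n))
    (EuclideanSpace ℝ (Fin n)) ℝ ξ).continuous.continuousAt.comp h
  refine h2.congr (Eventually.of_forall fun x => ?_)
  -- the tangent bundle of `ℝⁿ` and the trivial line bundle are trivialized by the identity
  ext v
  simp [inTangentCoordinates, ContinuousLinearMap.inCoordinates, chartCovector]
  rfl

/-- A vector whose coordinates `w` satisfy `|ξ w| ≤ P ξ` for all the covectors with constant
coordinates is subunit. -/
theorem isSubunit_symm_of_forall_chartCovector (hφ : φ ∈ IsManifold.maximalAtlas (𝓡 n) ∞ M) {x : M}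
    (hx : x ∈ φ.source) {w : EuclideanSpace ℝ (Fin n)}
    (hw : ∀ ξ : EuclideanSpace ℝ (Fin n) →L[ℝ] ℝ, |ξ w| ≤ P.seminorm x (chartCovector φ ξ x)) :
    P.IsSubunit x (((mdifferentiable_of_mem_maximalAtlas_infty hφ).mfderiv hx).symm w) := by
  set e := (mdifferentiable_of_mem_maximalAtlas_infty hφ).mfderiv hx
  rw [FibreSeminorm.isSubunit_iff]
  intro η
  let ξ : EuclideanSpace ℝ (Fin n) →L[ℝ] ℝ := η.comp e.symm.toContinuousLinearMap
  have hξ : chartCovector φ ξ x = η := by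
    ext v
    change η (e.symm (e v)) = η v
    rw [e.symm_apply_apply]
  have := hw ξ
  rwa [hξ] at this

theorem FibreSeminorm.IsSubunit.abs_apply_mfderiv_le {x : M} {v : TangentSpace (𝓡 n) x}
    (hv : P.IsSubunit x v) (ξ : EuclideanSpace ℝ (Fin n) →L[ℝ] ℝ) :
    |ξ (mfderiv (𝓡 n) (𝓡 n) φ x v)| ≤ P.seminorm x (chartCovector φ ξ x) :=
  FibreSeminorm.isSubunit_iff.1 hv (chartCovector φ ξ x)

/-! ### Global subunit fields -/

theorem isSubunitField_cutoffField [T2Space M] (hφ : φ ∈ IsManifold.maximalAtlas (𝓡 n) ∞ M)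
    (htarget : φ.target = univ) {χ : EuclideanSpace ℝ (Fin n) → ℝ} (hχ : ContDiff ℝ ∞ χ)
    (hχs : HasCompactSupport χ) (hχ1 : ∀ p, |χ p| ≤ 1) {X : ∀ x : M, TangentSpace (𝓡 n) x}
    (hX : P.IsSubunitFieldOn X φ.source) : P.IsSubunitField (cutoffField φ χ X) := by
  refine ⟨?_, fun x _ => ?_⟩
  · rw [contMDiffOn_univ]
    intro x
    by_cases hx : x ∈ φ.source
    · have h1 : ContMDiffAt (𝓡 n) 𝓘(ℝ, ℝ) ∞ (φ.source.indicator fun x => χ (φ x)) x := by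
        refine (hχ.contMDiff.contMDiffAt.comp x
          (contMDiffAt_of_mem_maximalAtlas hφ hx)).congr_of_eventuallyEq ?_
        filter_upwards [φ.open_source.mem_nhds hx] with y hy
        rw [indicator_of_mem hy, Function.comp_apply]
      exact h1.smul_section (hX.1.contMDiffAt (φ.open_source.mem_nhds hx))
    · -- off the domain of the chart, the field vanishes near `x`, because the support of the
      -- cutoff function is compact, hence closed in the Hausdorff space `M`
      have hK : IsClosed (φ.symm '' tsupport χ) :=
        (hχs.isCompact.image_of_continuousOn (φ.continuousOn_symm.mono
          (htarget ▸ subset_univ _))).isClosed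
      have hxK : x ∉ φ.symm '' tsupport χ := by
        rintro ⟨p, -, rfl⟩
        exact hx (φ.map_target (htarget ▸ mem_univ p))
      refine (Bundle.contMDiff_zeroSection ℝ
        (TangentSpace (𝓡 n) : M → Type _) x).congr_of_eventuallyEq ?_
      filter_upwards [hK.isOpen_compl.mem_nhds hxK] with y hy
      have : φ.source.indicator (fun x => χ (φ x)) y = 0 := by
        by_cases hys : y ∈ φ.source
        · rw [indicator_of_mem hys]
          by_contra hne
          exact hy ⟨φ y, subset_tsupport _ hne, φ.left_inv hys⟩
        · exact indicator_of_notMem hys _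
      rw [cutoffField, this, zero_smul]
      rfl
  · by_cases hx : x ∈ φ.source
    · refine (hX.2 x hx).smul ?_
      rw [indicator_of_mem hx]
      exact hχ1 _
    · rw [cutoffField, indicator_of_notMem hx, zero_smul]
      exact P.isSubunit_zero x

/-- The Lipschitz seminorm condition yields, for each smaller ball of radius `ρ < 1`, a family of
global subunit fields whose coordinate expressions are bounded and Lipschitz on all of `ℝⁿ`, with
a uniform constant, and whose values over the smaller ball are still dense in the unit balls
of `P*`. -/
theorem FibreSeminorm.LipschitzCondition.exists_global_family [T2Space M] {A : Type*}
    {𝒜 : BallAtlas n M A} (hP : P.LipschitzCondition 𝒜) (α : A) {ρ : ℝ} (hρ0 : 0 < ρ)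
    (hρ1 : ρ < 1) :
    ∃ (𝒳 : Set (∀ x : M, TangentSpace (𝓡 n) x)) (K : NNReal) (C : ℝ), 0 < K ∧
      (∀ X ∈ 𝒳, P.IsSubunitField X) ∧
      (∀ X ∈ 𝒳, LipschitzWith K (coordField (𝒜.φ α) X)) ∧
      (∀ X ∈ 𝒳, ∀ p, ‖coordField (𝒜.φ α) X p‖ ≤ C) ∧
      ∀ x ∈ (𝒜.φ α).source, 𝒜.φ α x ∈ Metric.ball 0 ρ → ∀ w,
        (∀ ξ : EuclideanSpace ℝ (Fin n) →L[ℝ] ℝ,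
          |ξ w| ≤ P.seminorm x (chartCovector (𝒜.φ α) ξ x)) →
        w ∈ closure ((fun X => coordField (𝒜.φ α) X (𝒜.φ α x)) '' 𝒳) := by
  obtain ⟨𝒳, L, -, hsub, hLip, hdense⟩ := hP α
  have hφ := 𝒜.smooth α
  have htgt : ∀ p, p ∈ (𝒜.φ α).target := fun p => 𝒜.target_eq α ▸ mem_univ p
  set φ := 𝒜.φ α
  set E := EuclideanSpace ℝ (Fin n)
  set B : Set E := Metric.ball 0 1
  have h0B : (0 : E) ∈ B := Metric.mem_ball_self one_pos
  -- a uniform bound at the centre of the ball propagates by the Lipschitz condition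
  set C₀ : ℝ := ∑ j : Fin n, P.seminorm (φ.symm 0)
    (chartCovector φ (EuclideanSpace.proj j : E →L[ℝ] ℝ) (φ.symm 0))
  have hC₀ : ∀ X ∈ 𝒳, ‖coordField φ X 0‖ ≤ C₀ := by
    intro X hX
    refine (EuclideanSpace.norm_le_sum_abs_apply _).trans (Finset.sum_le_sum fun j _ => ?_)
    exact ((hsub X hX).2 _ (φ.map_target (htgt 0))).abs_apply_mfderiv_le
      (EuclideanSpace.proj j : E →L[ℝ] ℝ)
  have hLip' : ∀ X ∈ 𝒳, LipschitzOnWith L.toNNReal (coordField φ X) B := by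
    intro X hX
    refine LipschitzOnWith.of_dist_le_mul fun p hp q hq => ?_
    rw [dist_eq_norm, dist_eq_norm]
    exact (hLip X hX p hp q hq).trans
      (mul_le_mul_of_nonneg_right (Real.le_coe_toNNReal L) (norm_nonneg _))
  set C : NNReal := C₀.toNNReal + L.toNNReal
  have hC : ∀ X ∈ 𝒳, ∀ p ∈ B, ‖coordField φ X p‖ ≤ C := by
    intro X hX p hp
    have h1 := (hLip' X hX).dist_le_mul p hp 0 h0B
    rw [dist_eq_norm, dist_zero_right] at h1
    have h2 : (L.toNNReal : ℝ) * ‖p‖ ≤ L.toNNReal :=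
      mul_le_of_le_one_right L.toNNReal.2 (mem_ball_zero_iff.1 hp).le
    have h3 := norm_le_norm_add_norm_sub' (coordField φ X p) (coordField φ X 0)
    have h4 := (hC₀ X hX).trans (Real.le_coe_toNNReal C₀)
    simp only [C, NNReal.coe_add]
    linarith
  let χ : ContDiffBump (0 : E) := ⟨ρ, (ρ + 1) / 2, hρ0, by linarith⟩
  have hχ1 : ∀ p, |χ p| ≤ 1 := fun p => by
    rw [abs_of_nonneg χ.nonneg]
    exact χ.le_one
  have hχB : ∀ p ∉ B, χ p = 0 := fun p hp => χ.zero_of_le_dist (by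
    have h1 : 1 ≤ dist p 0 := not_lt.1 hp
    change (ρ + 1) / 2 ≤ _
    linarith)
  have hχsmooth : ContDiff ℝ ∞ χ := χ.contDiff
  obtain ⟨Kχ, hKχ⟩ := hχsmooth.lipschitzWith_of_hasCompactSupport χ.hasCompactSupport (by simp)
  have hcoord : ∀ X, coordField φ (cutoffField φ χ X) = fun p => χ p • coordField φ X p :=
    fun X => funext fun p => coordField_cutoffField X (htgt p)
  refine ⟨cutoffField φ χ '' 𝒳, L.toNNReal + Kχ * C + 1, C, by positivity, ?_, ?_, ?_, ?_⟩
  · rintro _ ⟨X, hX, rfl⟩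
    exact isSubunitField_cutoffField hφ (𝒜.target_eq α) hχsmooth χ.hasCompactSupport hχ1
      (hsub X hX)
  · rintro _ ⟨X, hX, rfl⟩
    rw [hcoord]
    exact (lipschitzWith_smul_of_support_subset hKχ hχ1 hχB (hLip' X hX) (hC X hX)).weaken
      le_self_add
  · rintro _ ⟨X, hX, rfl⟩ p
    rw [hcoord, norm_smul, Real.norm_eq_abs]
    by_cases hp : p ∈ B
    · exact (mul_le_of_le_one_left (norm_nonneg _) (hχ1 p)).trans (hC X hX p hp)
    · rw [hχB p hp, abs_zero, zero_mul]
      exact C.2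
  · intro x hx hxρ w hw
    have hχx : χ (φ x) = 1 := χ.one_of_mem_closedBall (Metric.ball_subset_closedBall hxρ)
    set e := (mdifferentiable_of_mem_maximalAtlas_infty hφ).mfderiv hx
    have hv : e.symm w ∈ closure {v : TangentSpace (𝓡 n) x | ∃ X ∈ 𝒳, X x = v} := by
      rw [hdense x ⟨hx, Metric.ball_subset_ball hρ1.le hxρ⟩]
      exact isSubunit_symm_of_forall_chartCovector hφ hx hw
    have h1 := image_closure_subset_closure_image e.continuous (mem_image_of_mem e hv)
    refine closure_mono ?_ ((congrArg (· ∈ closure _) (e.apply_symm_apply w)).mp h1)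
    rintro _ ⟨_, ⟨X, hX, rfl⟩, rfl⟩
    refine ⟨_, mem_image_of_mem _ hX, ?_⟩
    have h2 : coordField φ (cutoffField φ χ X) (φ x) = coordField φ X (φ x) := by
      simp only [hcoord, hχx, one_smul]
    exact h2.trans (coordField_apply_of_mem_source X hx)

variable {A : Type*} {𝒜 : BallAtlas n M A} {γ : ℝ → M}

/-! ### Chords of subunit curves -/

theorem FibreSeminorm.IsSubunitCurve.mono {a b c d : ℝ} (hγ : P.IsSubunitCurve 𝒜 γ a b)
    (hac : a ≤ c) (hdb : d ≤ b) : P.IsSubunitCurve 𝒜 γ c d := by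
  have hsub : Icc c d ⊆ Icc a b := Icc_subset_Icc hac hdb
  refine ⟨⟨hγ.1.1.mono hsub, fun α s t hs hst ht h =>
    hγ.1.2 α s t (hac.trans hs) hst (ht.trans hdb) h⟩, ?_⟩
  filter_upwards [ae_restrict_of_ae_restrict_of_subset hsub hγ.2] with t ⟨v, hv, hvP⟩
  exact ⟨v, hv.mono hsub, hvP⟩

/-- A functional of constant coordinates `ξ` grows along a subunit curve at most at the rate that
bounds `P` at the pullback of `ξ`. -/
theorem FibreSeminorm.IsSubunitCurve.abs_apply_sub_le {α : A} {s t C : ℝ} (hst : s ≤ t)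
    (hγ : P.IsSubunitCurve 𝒜 γ s t) (hU : ∀ τ ∈ Icc s t, γ τ ∈ (𝒜.φ α).source)
    (ξ : EuclideanSpace ℝ (Fin n) →L[ℝ] ℝ)
    (hC : ∀ τ ∈ Icc s t, P.seminorm (γ τ) (chartCovector (𝒜.φ α) ξ (γ τ)) ≤ C) :
    |ξ (𝒜.φ α (γ t) - 𝒜.φ α (γ s))| ≤ C * (t - s) := by
  rw [map_sub]
  refine (ξ.lipschitz.comp_absolutelyContinuousOnInterval
    (hγ.1.2 α s t le_rfl hst le_rfl hU)).abs_sub_le_of_ae_abs_deriv_le hst ?_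
  have hIoo : ∀ᵐ τ ∂(volume.restrict (Icc s t)), τ ∈ Ioo s t := by
    rw [← restrict_Ioo_eq_restrict_Icc]
    exact ae_restrict_mem measurableSet_Ioo
  filter_upwards [hγ.2, hIoo] with τ ⟨v, hv, hvP⟩ hτ
  have hτ' := Ioo_subset_Icc_self hτ
  have h1 := hv.hasMFDerivAt (Icc_mem_nhds hτ.1 hτ.2)
  have h2 := ((mdifferentiable_of_mem_maximalAtlas_infty (𝒜.smooth α)).mdifferentiableAt
    (hU τ hτ')).hasMFDerivAt.comp τ h1
  have h3 := (hasMFDerivAt_iff_hasFDerivAt.1 h2)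
  have h4 := (ξ.hasFDerivAt.comp τ h3).hasDerivAt
  have h5 : deriv (fun t => ξ (𝒜.φ α (γ t))) τ =
      ξ (mfderiv (𝓡 n) (𝓡 n) (𝒜.φ α) (γ τ) v) := by
    refine h4.deriv.trans ?_
    have h6 : ((1 : ℝ →L[ℝ] ℝ).smulRight v) (1 : ℝ) = v := by simp
    exact congrArg (fun u => ξ (mfderiv (𝓡 n) (𝓡 n) (𝒜.φ α) (γ τ) u)) h6
  rw [h5]
  exact (hvP.abs_apply_mfderiv_le ξ).trans (hC τ hτ')

/-- Near each time `t₀`, the chords of a subunit curve are nearly parallel to one of the fields of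
a family whose values are dense in the unit ball of `P*`. Convexity of that ball enters through its
description by functionals, so that no measurable selection of fields along the curve is needed. -/
theorem FibreSeminorm.IsSubunitCurve.exists_chord_approx {α : A} {a b ε t₀ : ℝ}
    (hγ : P.IsSubunitCurve 𝒜 γ a b) (hU : ∀ τ ∈ Icc a b, γ τ ∈ (𝒜.φ α).source)
    (ht₀ : t₀ ∈ Icc a b) (hε : 0 < ε) {𝒳 : Set (∀ x : M, TangentSpace (𝓡 n) x)} {K : NNReal}
    (hK0 : 0 < K) (hK : ∀ X ∈ 𝒳, LipschitzWith K (coordField (𝒜.φ α) X))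
    (hdense : ∀ w, (∀ ξ : EuclideanSpace ℝ (Fin n) →L[ℝ] ℝ,
          |ξ w| ≤ P.seminorm (γ t₀) (chartCovector (𝒜.φ α) ξ (γ t₀))) →
        w ∈ closure ((fun X => coordField (𝒜.φ α) X (𝒜.φ α (γ t₀))) '' 𝒳)) :
    ∃ r > 0, ∀ s ∈ Metric.ball t₀ r ∩ Icc a b, ∀ t ∈ Metric.ball t₀ r ∩ Icc a b, s < t →
      ∃ X ∈ 𝒳, ∀ z ∈ segment ℝ (𝒜.φ α (γ s)) (𝒜.φ α (γ t)),
        ‖(t - s)⁻¹ • (𝒜.φ α (γ t) - 𝒜.φ α (γ s)) - coordField (𝒜.φ α) X z‖ ≤ ε := by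
  set φ := 𝒜.φ α
  set c : ℝ → EuclideanSpace ℝ (Fin n) := fun t => φ (γ t)
  have hc : ContinuousOn c (Icc a b) := φ.continuousOn.comp hγ.1.1 hU
  set l : Filter (ℝ × ℝ) := (𝓝[Icc a b] t₀ ×ˢ 𝓝[Icc a b] t₀) ⊓ 𝓟 {q | q.1 < q.2}
  have hbasis := (Metric.nhdsWithin_basis_ball (x := t₀) (s := Icc a b)).prod_self
  have hlim : ∀ ξ : EuclideanSpace ℝ (Fin n) →L[ℝ] ℝ, ∀ η > 0, ∀ᶠ q in l,
      |ξ ((q.2 - q.1)⁻¹ • (c q.2 - c q.1))| ≤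
        P.seminorm (γ t₀) (chartCovector φ ξ (γ t₀)) + η := by
    intro ξ η hη
    have hcont : ContinuousOn (fun τ => P.seminorm (γ τ) (chartCovector φ ξ (γ τ))) (Icc a b) :=
      P.continuous.comp_continuousOn
        ((continuousOn_chartCovector (𝒜.smooth α) ξ).comp hγ.1.1 hU)
    have hev := (hcont t₀ ht₀).eventually_le_const (lt_add_of_pos_right _ hη)
    obtain ⟨r, hr, hball⟩ := Metric.nhdsWithin_basis_ball.eventually_iff.1 hev
    rw [eventually_inf_principal, hbasis.eventually_iff]
    refine ⟨r, hr, fun {q} hq hlt => ?_⟩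
    have hpos : 0 < q.2 - q.1 := sub_pos.2 hlt
    have hIcc : Icc q.1 q.2 ⊆ Metric.ball t₀ r ∩ Icc a b :=
      (Real.ball_eq_Ioo t₀ r ▸ ordConnected_Ioo.inter ordConnected_Icc).out hq.1 hq.2
    have h1 := (hγ.mono hq.1.2.1 hq.2.2.2).abs_apply_sub_le (α := α) (le_of_lt hlt)
      (fun τ hτ => hU τ (hIcc hτ).2) ξ (fun τ hτ => hball (hIcc hτ))
    rw [map_smul, smul_eq_mul, abs_mul, abs_of_pos (inv_pos.2 hpos), inv_mul_le_iff₀ hpos,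
      mul_comm]
    exact h1
  have hev := eventually_exists_norm_sub_lt_of_forall_functional hlim hdense (half_pos hε)
  rw [eventually_inf_principal, hbasis.eventually_iff] at hev
  obtain ⟨r₁, hr₁, h₁⟩ := hev
  -- over this ball the fields vary by at most `ε / 2`
  have hK' : (0 : ℝ) < K := hK0
  have hnear := (hc t₀ ht₀).eventually (Metric.ball_mem_nhds _ (div_pos (half_pos hε) hK'))
  obtain ⟨r₂, hr₂, h₂⟩ := Metric.nhdsWithin_basis_ball.eventually_iff.1 hnear
  refine ⟨min r₁ r₂, lt_min hr₁ hr₂, fun s hs t ht hst => ?_⟩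
  have b1 : Metric.ball t₀ (min r₁ r₂) ⊆ Metric.ball t₀ r₁ :=
    Metric.ball_subset_ball (min_le_left _ _)
  have b2 : Metric.ball t₀ (min r₁ r₂) ⊆ Metric.ball t₀ r₂ :=
    Metric.ball_subset_ball (min_le_right _ _)
  obtain ⟨_, ⟨X, hX, rfl⟩, hXw⟩ := h₁ (x := (s, t)) ⟨⟨b1 hs.1, hs.2⟩, ⟨b1 ht.1, ht.2⟩⟩ hst
  refine ⟨X, hX, fun z hz => ?_⟩
  have hzball := (convex_ball (c t₀) (ε / 2 / K)).segment_subset (h₂ ⟨b2 hs.1, hs.2⟩)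
    (h₂ ⟨b2 ht.1, ht.2⟩) hz
  have h3 := (hK X hX).dist_le_mul (c t₀) z
  rw [dist_comm (c t₀) z, dist_eq_norm] at h3
  have h4 : (K : ℝ) * dist z (c t₀) ≤ ε / 2 := by
    have := (lt_div_iff₀' hK').1 (Metric.mem_ball.1 hzball)
    exact this.le
  have h5 := norm_sub_le_norm_sub_add_norm_sub ((t - s)⁻¹ • (c t - c s))
    (coordField φ X (c t₀)) (coordField φ X z)
  exact h5.trans (by linarith [hXw.le])

/-! ### Following a subunit curve -/

/-- A subunit curve inside a single set `V α` can be followed: with the chords over a fine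
subdivision replaced by flows, the error, measured in the chart, is controlled by Grönwall's
inequality. -/
theorem FibreSeminorm.LipschitzCondition.exists_flowReach_of_mem_V [T2Space M]
    (hP : P.LipschitzCondition 𝒜) {α : A} {a b : ℝ} (hab : a ≤ b)
    (hγ : P.IsSubunitCurve 𝒜 γ a b) (hV : ∀ τ ∈ Icc a b, γ τ ∈ 𝒜.V α) {ε : ℝ} (hε : 0 < ε) :
    ∃ δ > 0, ∀ y, dist y (𝒜.φ α (γ a)) < δ → ∃ z, dist z (𝒜.φ α (γ b)) < ε ∧
      P.FlowReach a ((𝒜.φ α).symm y) b ((𝒜.φ α).symm z) := by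
  set φ := 𝒜.φ α
  set c : ℝ → EuclideanSpace ℝ (Fin n) := fun t => φ (γ t)
  have hU : ∀ τ ∈ Icc a b, γ τ ∈ φ.source := fun τ hτ => (hV τ hτ).1
  have hc : ContinuousOn c (Icc a b) := φ.continuousOn.comp hγ.1.1 hU
  -- by compactness the curve stays in a smaller ball, which leaves room for a cutoff
  obtain ⟨ρ, hρ0, hρ1, hρ⟩ : ∃ ρ : ℝ, 0 < ρ ∧ ρ < 1 ∧ ∀ τ ∈ Icc a b, c τ ∈ Metric.ball 0 ρ := by
    obtain ⟨τ₀, hτ₀, hmax⟩ := isCompact_Icc.exists_isMaxOn (nonempty_Icc.2 hab) hc.norm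
    have h1 : ‖c τ₀‖ < 1 := mem_ball_zero_iff.1 (hV τ₀ hτ₀).2
    refine ⟨(‖c τ₀‖ + 1) / 2, by positivity, by linarith, fun τ hτ => ?_⟩
    have h2 : ‖c τ‖ ≤ ‖c τ₀‖ := hmax hτ
    exact mem_ball_zero_iff.2 (by linarith)
  obtain ⟨𝒳, K, C, hK0, hsub, hLip, hC, hdense⟩ := hP.exists_global_family α hρ0 hρ1
  have hK' : (0 : ℝ) < K := hK0
  set Q := Real.exp (K * (b - a))
  have hQ : 0 < Q := Real.exp_pos _
  -- with this precision for the slopes of the chords, Grönwall's inequality gives the error `ε`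
  set ε' := K * (ε / (2 * Q))
  have hε' : 0 < ε' := by positivity
  have hε'K : ε' / K = ε / (2 * Q) := by simp only [ε']; field_simp
  have hloc : ∀ t₀ : Icc a b, _ := fun t₀ => hγ.exists_chord_approx (α := α) hU t₀.2 hε' hK0 hLip
    (hdense _ (hU _ t₀.2) (hρ _ t₀.2))
  choose r hr happrox using hloc
  obtain ⟨t, ht0, htmono, ⟨m, hm⟩, htc⟩ := exists_monotone_Icc_subset_open_cover_Icc hab
    (c := fun t₀ : Icc a b => Metric.ball t₀ (r t₀)) (fun _ => Metric.isOpen_ball)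
    (fun t₀ _ => mem_iUnion.2 ⟨t₀, Metric.mem_ball_self (hr t₀)⟩)
  have hiter : ∀ y, ∀ k, ∃ z, P.FlowReach a (φ.symm y) (t k) (φ.symm z) ∧
      dist z (c (t k)) + ε' / K ≤ (dist y (c a) + ε' / K) * Real.exp (K * (t k - a)) := by
    intro y k
    induction k with
    | zero =>
      refine ⟨y, ?_, ?_⟩
      · rw [ht0]
        exact .refl _ _
      · rw [ht0]
        simp
    | succ k ih =>
      obtain ⟨z, hz, hdist⟩ := ih
      have hle : (t k : ℝ) ≤ t (k + 1) := htmono k.le_succ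
      rcases hle.eq_or_lt with heq | hlt
      · rw [← heq]
        exact ⟨z, hz, hdist⟩
      obtain ⟨t₀, ht₀⟩ := htc k
      obtain ⟨X, hX, hchord⟩ := happrox t₀ (t k)
        ⟨ht₀ (left_mem_Icc.2 (htmono k.le_succ)), (t k).2⟩ (t (k + 1))
        ⟨ht₀ (right_mem_Icc.2 (htmono k.le_succ)), (t (k + 1)).2⟩ hlt
      obtain ⟨d, hda, hd, hcurve⟩ := exists_isMIntegralCurveOn_symm (𝒜.smooth α)
        (𝒜.target_eq α) (hLip X hX) (hC X hX) hle z
      refine ⟨d (t (k + 1)), ?_, ?_⟩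
      · rw [← hda] at hz
        exact .snoc (σ := fun τ => φ.symm (d τ)) hz hle (hsub X hX) hcurve
      · have hg := dist_add_le_of_chord hK0 (hLip X hX) hlt hchord hd
        rw [hda] at hg
        refine hg.trans ((mul_le_mul_of_nonneg_right hdist (Real.exp_pos _).le).trans_eq ?_)
        rw [mul_assoc, ← Real.exp_add]
        congr 2
        ring
  refine ⟨ε / (2 * Q), by positivity, fun y hy => ?_⟩
  obtain ⟨z, hz, hdist⟩ := hiter y m
  rw [hm m le_rfl] at hz hdist
  refine ⟨z, ?_, hz⟩
  rw [hε'K] at hdist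
  have h1 : (dist y (c a) + ε / (2 * Q)) * Q < ε := by
    calc (dist y (c a) + ε / (2 * Q)) * Q < (ε / (2 * Q) + ε / (2 * Q)) * Q := by gcongr
      _ = ε := by field_simp; ring
  have h2 : 0 < ε / (2 * Q) := by positivity
  change dist z (c b) < ε
  linarith

end SubFinsler

theorem mainTheorem5 {n : ℕ} {M : Type*} [TopologicalSpace M] [T2Space M] [SigmaCompactSpace M]
    [ChartedSpace (EuclideanSpace ℝ (Fin n)) M] [IsManifold (𝓡 n) ∞ M]
    {A : Type*} (𝒜 : SubFinsler.BallAtlas n M A) (P : SubFinsler.FibreSeminorm n M)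
    (hP : P.LipschitzCondition 𝒜)
    (T : ℝ) (hT : 0 ≤ T) (γ : ℝ → M) (hγ : P.IsSubunitCurve 𝒜 γ 0 T) :
    ∀ W ∈ nhds (γ T), ∃ U ∈ nhds (γ 0), ∀ x ∈ U,
      ∃ δ : ℝ → M, P.IsPiecewiseFlowCurve δ 0 T ∧ δ 0 = x ∧ δ T ∈ W := by
  have hVopen : ∀ α, IsOpen (𝒜.V α) := fun α =>
    (𝒜.φ α).isOpen_inter_preimage Metric.isOpen_ball
  have hcont : Continuous fun t : Icc (0 : ℝ) T => γ t := hγ.1.1.domRestrict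
  obtain ⟨t, ht0, htmono, ⟨m, hm⟩, htc⟩ := exists_monotone_Icc_subset_open_cover_Icc hT
    (c := fun α : A => (fun t : Icc (0 : ℝ) T => γ t) ⁻¹' 𝒜.V α)
    (fun α => (hVopen α).preimage hcont)
    (fun τ _ => mem_iUnion.2 (𝒜.cover (γ τ)))
  have hstep : ∀ k, ∀ W ∈ 𝓝 (γ (t k)), ∃ U ∈ 𝓝 (γ 0), ∀ x ∈ U, ∃ y ∈ W,
      P.FlowReach 0 x (t k) y := by
    intro k
    induction k with
    | zero =>
      rw [ht0]
      exact fun W hW => ⟨W, hW, fun x hx => ⟨x, hx, .refl _ _⟩⟩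
    | succ k ih =>
      intro W hW
      have hle : (t k : ℝ) ≤ t (k + 1) := htmono k.le_succ
      obtain ⟨α, hα⟩ := htc k
      have hV : ∀ τ ∈ Icc (t k : ℝ) (t (k + 1)), γ τ ∈ 𝒜.V α := fun τ hτ =>
        hα (show ⟨τ, (t k).2.1.trans hτ.1, hτ.2.trans (t (k + 1)).2.2⟩ ∈ Icc (t k) (t (k + 1))
          from hτ)
      have hsk := (hV _ (left_mem_Icc.2 hle)).1
      have hsk' := (hV _ (right_mem_Icc.2 hle)).1
      -- transport `W` to the chart
      have hW' : ∀ᶠ z in 𝓝 (𝒜.φ α (γ (t (k + 1)))), (𝒜.φ α).symm z ∈ W := by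
        refine ((𝒜.φ α).continuousAt_symm ((𝒜.φ α).map_source hsk')).eventually ?_
        rwa [(𝒜.φ α).left_inv hsk']
      obtain ⟨ε, hε, hball⟩ := Metric.eventually_nhds_iff.1 hW'
      obtain ⟨δ, hδ, hreach⟩ := hP.exists_flowReach_of_mem_V hle
        (hγ.mono (t k).2.1 (t (k + 1)).2.2) hV hε
      have hW₁ : {x | x ∈ (𝒜.φ α).source ∧ dist (𝒜.φ α x) (𝒜.φ α (γ (t k))) < δ} ∈
          𝓝 (γ (t k)) :=
        inter_mem ((𝒜.φ α).open_source.mem_nhds hsk)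
          (((𝒜.φ α).continuousAt hsk).eventually (Metric.ball_mem_nhds _ hδ))
      obtain ⟨U, hU, hUW⟩ := ih _ hW₁
      refine ⟨U, hU, fun x hx => ?_⟩
      obtain ⟨y, ⟨hys, hyd⟩, hxy⟩ := hUW x hx
      obtain ⟨z, hz, hyz⟩ := hreach _ hyd
      rw [(𝒜.φ α).left_inv hys] at hyz
      exact ⟨_, hball hz, hxy.trans hyz⟩
  intro W hW
  obtain ⟨U, hU, hUW⟩ := hstep m W (by rwa [hm m le_rfl])
  refine ⟨U, hU, fun x hx => ?_⟩
  obtain ⟨y, hy, hxy⟩ := hUW x hx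
  rw [hm m le_rfl] at hxy
  obtain ⟨δ, hδ, hδ0, hδT⟩ := hxy.exists_isPiecewiseFlowCurve
  exact ⟨δ, hδ, hδ0, hδT ▸ hy⟩
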